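/- **Setting.** Let $b(t)=(b_1(t),\dots,b_m(t))^T$ be an $m$-channel boson field on a complex Hilbert space $\mathfrak H$, i.e. a representation of the canonical commutation relations $[b_i(t),b_j(r)^*]=\delta_{ij}\delta(t-r)$, $[b_i(t),b_j(r)]=0$: for wave packets $f$ in a dense, conjugation-stable subspace of $L^2(\mathbb R)$ (possibly all of it), the smeared operators $B_i(f)=\int f(t)^*b_i(t)\,dt$ and $B_i^*(f)=\int f(t)\,b_i(t)^*\,dt$ map a common dense domain into itself, are mutually adjoint there, and satisfy $[B_i(f),B_j^*(g)]=\delta_{ij}\langle f,g\rangle$, $[B_i(f),B_j(g)]=0=[B_i^*(f),B_j^*(g)]$. Put $\breve b=(b_1,\dots,b_m,b_1^*,\dots,b_m^*)^T$, $J=\mathrm{diag}(I_m,-I_m)$ and $\Theta=\begin{pmatrix}0&I_m\\-I_m&0\end{pmatrix}$. For a vector or matrix, $\#$ denotes the entrywise complex conjugate or adjoint, and $\otimes$ denotes the Kronecker product. Let $\rho_R=\sum_n p_n|\psi_n\rangle\langle\psi_n|$ be a density operator ($p_n\ge 0$, $\sum_n p_n=1$, $\psi_n$ unit vectors in the domain),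 all of whose field moments are finite (that is, $\sum_n p_n\|A\psi_n\|^2<\infty$ for every polynomial $A$ in the smeared fields), which is a stationary zero-mean Gaussian state with spectral density matrix $R[i\omega]$: its first moments vanish, its higher moments are given by Wick's formula in terms of the second ones, and $\mathrm{Tr}[\rho_R\,\breve b(t)\breve b^\dagger(r)]=\frac1{2\pi}\int e^{i\omega(t-r)}R[i\omega]\,d\omega$ in the sense of distributions. Moments of unsmeared fields such as $\mathrm{Tr}[\rho_R\,\breve b(t_1)\otimes\cdots\otimes\breve b(t_K)]$ are understood as distributions in $(t_1,\dots,t_K)$, whose pairing with a product $\varphi_1(t_1)\cdots\varphi_K(t_K)$ of wave packets is the moment $\mathrm{Tr}[\rho_R\,\textstyle\int\varphi_1\breve b_{c_1}\cdots\int\varphi_K\breve b_{c_K}]$ of the smeared fields. Let $\ell_1,\dots,\ell_m\ge 0$ be photon numbers, $L=\ell_1+\cdots+\ell_m$, let $N_{\ell_1},\dots,N_{\ell_m}>0$ be constants, let $\xi^-_{ijk},\xi^+_{ijk}$ ($1\le i,j\le m$, $1\le k\le\ell_j$) be wave packets, and let $\xi_{:jk}(t)=\begin{pmatrix}\xi^-_{:jk}(t)\\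 \xi^+_{:jk}(t)^\#\end{pmatrix}\in\mathbb C^{2m}$. Define $$X=\prod_{j=1}^m\frac1{\sqrt{N_{\ell_j}}}\prod_{k=1}^{\ell_j}\sum_{i=1}^m\bigl(B_i^*(\xi^-_{ijk})-B_i(\xi^+_{ijk})\bigr),\qquad \rho_{\xi,R}=X\rho_RX^*=\sum_n p_n|X\psi_n\rangle\langle X\psi_n|,$$ with the factors of $X$ ordered from left to right by increasing $(j,k)$. Enumerate the pairs $(j,k)$ lexicographically as $s_1,\dots,s_L$, and put $c_N=\prod_j N_{\ell_j}^{-1/2}$, $$M_\xi(t_1,\dots,t_L)=c_N\,\xi_{:s_1}(t_1)\otimes\cdots\otimes\xi_{:s_L}(t_L),\qquad M^+_\xi(t_1,\dots,t_L)=c_N\,\xi_{:s_L}(t_1)\otimes\cdots\otimes\xi_{:s_1}(t_L).$$ The *normalization condition* for $(\xi,\rho_R)$ is $$\int_{\mathbb R^{2L}}\bigl(M_\xi^+(t_1,\dots,t_L)^\#\otimes M_\xi(t_{L+1},\dots,t_{2L})\bigr)^T\,\bigl(J^{\otimes L}\otimes\Theta^{\otimes L}\bigr)\,\mathrm{Tr}\bigl[\rho_R\,\breve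 b(t_1)\otimes\cdots\otimes\breve b(t_{2L})\bigr]\,dt_1\cdots dt_{2L}=1. \tag{$*$}$$ The class $\mathcal F_0$ of *photon-Gaussian states* consists of all operators $\rho_{\xi,R}$ for which $\xi$ and $\rho_R$ satisfy $(*)$. **Proposition.** Every photon-Gaussian state $\rho_{\xi,R}\in\mathcal F_0$ is normalized: $\mathrm{Tr}[\rho_{\xi,R}]=1$, that is, for every orthonormal basis $(e_\iota)$ of $\mathfrak H$ the sum $\sum_\iota\langle e_\iota,\rho_{\xi,R}\,e_\iota\rangle$ converges to $1$. Moreover, for all $\xi$ and $\rho_R$ as above, $\mathrm{Tr}[\rho_{\xi,R}]=1$ if and only if $(*)$ holds. -/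

import Mathlib

open MeasureTheory
open scoped FourierTransform TensorProduct ComplexConjugate

noncomputable section

universe u

/-- The space `L²(ℝ; ℂ)` of square integrable functions of time. -/
abbrev L2Time : Type := Lp ℂ 2 (volume : Measure ℝ)

theorem L2Time.star_add (f g : L2Time) : star (f + g) = star f + star g := by
  apply Lp.ext
  filter_upwards [Lp.coeFn_star (f + g), Lp.coeFn_star f, Lp.coeFn_star g, Lp.coeFn_add f g,
    Lp.coeFn_add (star f) (star g)] with t h1 h2 h3 h4 h5
  rw [h1, h5]
  simp only [Pi.star_apply, Pi.add_apply] at h2 h3 h4 ⊢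
  rw [h4, h2, h3]
  simp

theorem L2Time.star_smul (c : ℂ) (f : L2Time) : star (c • f) = conj c • star f := by
  apply Lp.ext
  filter_upwards [Lp.coeFn_star (c • f), Lp.coeFn_star f, Lp.coeFn_smul c f,
    Lp.coeFn_smul (conj c) (star f)] with t h1 h2 h3 h4
  rw [h1, h4]
  simp only [Pi.star_apply, Pi.smul_apply] at h2 h3 ⊢
  rw [h3, h2]
  simp

/-! ### Boson fields -/

/-- An `m`-channel continuous-mode boson field `b(t) = (b₁(t), …, b_m(t))` on a Hilbert space `H`,
i.e. a representation of the canonical commutation relations `[b_i(t), b_j(r)^*] = δ_ij δ(t - r)`,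
`[b_i(t), b_j(r)] = 0`. The operator-valued distributions `b_i`, `b_i^*` are given in smeared form:
`ann i f` is `B_i(f) = ∫ f(t)^* b_i(t) dt` and `cre i f` is `B_i^*(f) = ∫ f(t) b_i(t)^* dt`.
They are unbounded operators which preserve a common dense domain `dom`, and they are defined for
the wave packets `f` in a dense subspace `packets` of `L²(ℝ)` that is stable under complex
conjugation (it may be all of `L²(ℝ)`). -/
structure BosonField (m : ℕ) (H : Type u) [NormedAddCommGroup H] [InnerProductSpace ℂ H] where
  packets : Submodule ℂ L2Time
  dense_packets : Dense (packets : Set L2Time)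
  star_mem : ∀ f ∈ packets, star f ∈ packets
  dom : Submodule ℂ H
  dense_dom : Dense (dom : Set H)
  ann : Fin m → packets →ₗ⋆[ℂ] Module.End ℂ dom
  cre : Fin m → packets →ₗ[ℂ] Module.End ℂ dom
  adjoint : ∀ (i : Fin m) (f : packets) (x y : dom),
    inner ℂ (cre i f x : H) (y : H) = inner ℂ (x : H) (ann i f y : H)
  ann_cre : ∀ (i j : Fin m) (f g : packets),
    ann i f * cre j g - cre j g * ann i f =
      (if i = j then inner ℂ (f : L2Time) (g : L2Time) else 0) • (1 : Module.End ℂ dom)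
  ann_ann : ∀ (i j : Fin m) (f g : packets), ann i f * ann j g = ann j g * ann i f
  cre_cre : ∀ (i j : Fin m) (f g : packets), cre i f * cre j g = cre j g * cre i f

/-- The index set of the components of the doubled-up column vector
`b̆ = (b₁, …, b_m, b₁^*, …, b_m^*)`. -/
abbrev DoubledIndex (m : ℕ) : Type := Fin m ⊕ Fin m

namespace BosonField

variable {m : ℕ} {H : Type u} [NormedAddCommGroup H] [InnerProductSpace ℂ H]

/-- Pointwise complex conjugation of a wave packet. -/
def conjPacket (F : BosonField m H) (f : F.packets) : F.packets :=
  ⟨star (f : L2Time), F.star_mem f f.2⟩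

/-- The `*`-algebra of polynomials in the smeared field operators. -/
def fieldAlg (F : BosonField m H) : Subalgebra ℂ (Module.End ℂ F.dom) :=
  Algebra.adjoin ℂ
    ({A | ∃ i f, A = F.ann i f} ∪ {A | ∃ i f, A = F.cre i f})

theorem ann_mem (F : BosonField m H) (i : Fin m) (f : F.packets) : F.ann i f ∈ F.fieldAlg :=
  Algebra.subset_adjoin (Or.inl ⟨i, f, rfl⟩)

theorem cre_mem (F : BosonField m H) (i : Fin m) (f : F.packets) : F.cre i f ∈ F.fieldAlg :=
  Algebra.subset_adjoin (Or.inr ⟨i, f, rfl⟩)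

/-- `B_i(f)` as an element of the field algebra. -/
def annOp (F : BosonField m H) (i : Fin m) (f : F.packets) : F.fieldAlg :=
  ⟨F.ann i f, F.ann_mem i f⟩

/-- `B_i^*(f)` as an element of the field algebra. -/
def creOp (F : BosonField m H) (i : Fin m) (f : F.packets) : F.fieldAlg :=
  ⟨F.cre i f, F.cre_mem i f⟩

/-- The components `∫ f(t) b̆_a(t) dt` of the smeared doubled-up field, which are complex linear
in `f`: the first `m` of them are `∫ f(t) b_i(t) dt = B_i(f^*)`, the last `m` of them are
`∫ f(t) b_i(t)^* dt = B_i^*(f)`. -/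
def smear (F : BosonField m H) : DoubledIndex m → F.packets →ₗ[ℂ] F.fieldAlg
  | Sum.inl i =>
    { toFun := fun f => F.annOp i (F.conjPacket f)
      map_add' := fun f g => by
        have h : F.conjPacket (f + g) = F.conjPacket f + F.conjPacket g :=
          Subtype.ext (L2Time.star_add f g)
        apply Subtype.ext
        simp [annOp, h]
      map_smul' := fun c f => by
        have h : F.conjPacket (c • f) = conj c • F.conjPacket f :=
          Subtype.ext (L2Time.star_smul c f)
        apply Subtype.ext
        simp [annOp, h] }
  | Sum.inr i =>
    { toFun := fun f => F.creOp i f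
      map_add' := fun f g => by
        apply Subtype.ext
        simp [creOp]
      map_smul' := fun c f => by
        apply Subtype.ext
        simp [creOp] }

/-- The formal adjoint `(∫ f(t) b̆_a(t) dt)^* = ∫ f(t)^* b̆_a(t)^* dt`; taking adjoints interchanges
the two halves of `b̆`. -/
def smearAdj (F : BosonField m H) (a : DoubledIndex m) (f : F.packets) : F.fieldAlg :=
  F.smear a.swap (F.conjPacket f)

end BosonField

/-! ### Density operators and traces -/

/-- `A` has a well-defined trace, equal to `t`: for every orthonormal basis the diagonal sum
converges (unconditionally) to `t`. -/
def HasTrace {H : Type u} [NormedAddCommGroup H] [InnerProductSpace ℂ H]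
    (A : H →L[ℂ] H) (t : ℂ) : Prop :=
  ∀ (ι : Type u) (e : HilbertBasis ι ℂ H), HasSum (fun i => inner ℂ (e i) (A (e i))) t

/-- A field state: a density operator `∑ₙ pₙ |ψₙ⟩⟨ψₙ|`, given as a statistical mixture of unit
vectors in the domain of the fields, all of whose moments of the fields are finite. -/
structure FieldState {m : ℕ} {H : Type u} [NormedAddCommGroup H] [InnerProductSpace ℂ H]
    (F : BosonField m H) where
  weight : ℕ → ℝ
  vec : ℕ → F.dom
  weight_nonneg : ∀ n, 0 ≤ weight n
  hasSum_weight : HasSum weight 1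
  norm_vec : ∀ n, ‖(vec n : H)‖ = 1
  moments : ∀ A ∈ F.fieldAlg, Summable fun n => weight n * ‖(A (vec n) : H)‖ ^ 2

namespace FieldState

variable {m : ℕ} {H : Type u} [NormedAddCommGroup H] [InnerProductSpace ℂ H]
  {F : BosonField m H}

/-- The operator `X ρ X^* = ∑ₙ pₙ |X ψₙ⟩⟨X ψₙ|` on `H`; for `X = 1` this is the density operator
`ρ` itself. -/
def sandwich (ρ : FieldState F) (X : F.fieldAlg) : H →L[ℂ] H :=
  ∑' n, (ρ.weight n : ℂ) •
    InnerProductSpace.rankOne ℂ ((X : Module.End ℂ F.dom) (ρ.vec n) : H)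
      ((X : Module.End ℂ F.dom) (ρ.vec n) : H)

theorem summable_expect (ρ : FieldState F) (A : F.fieldAlg) :
    Summable fun n => (ρ.weight n : ℂ) *
      inner ℂ (ρ.vec n : H) ((A : Module.End ℂ F.dom) (ρ.vec n) : H) := by
  have h := (ρ.hasSum_weight.summable).add (ρ.moments A A.2)
  refine Summable.of_norm_bounded h fun n => ?_
  have h1 := norm_inner_le_norm (𝕜 := ℂ) (ρ.vec n : H)
    ((A : Module.End ℂ F.dom) (ρ.vec n) : H)
  rw [ρ.norm_vec n, one_mul] at h1
  have h0 := ρ.weight_nonneg n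
  rw [norm_mul, Complex.norm_real, Real.norm_of_nonneg h0]
  nlinarith [sq_nonneg (‖((A : Module.End ℂ F.dom) (ρ.vec n) : H)‖ - 1),
    mul_le_mul_of_nonneg_left h1 h0,
    mul_nonneg h0 (sq_nonneg (‖((A : Module.End ℂ F.dom) (ρ.vec n) : H)‖ - 1)),
    mul_nonneg h0 (norm_nonneg ((A : Module.End ℂ F.dom) (ρ.vec n) : H))]

/-- The expectation `Tr[ρ A] = ∑ₙ pₙ ⟨ψₙ, A ψₙ⟩` of a polynomial `A` in the fields. -/
def expect (ρ : FieldState F) : F.fieldAlg →ₗ[ℂ] ℂ where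
  toFun A := ∑' n, (ρ.weight n : ℂ) *
    inner ℂ (ρ.vec n : H) ((A : Module.End ℂ F.dom) (ρ.vec n) : H)
  map_add' A B := by
    rw [← (ρ.summable_expect A).tsum_add (ρ.summable_expect B)]
    congr 1
    ext n
    simp [mul_add]
  map_smul' c A := by
    rw [RingHom.id_apply, smul_eq_mul, ← tsum_mul_left]
    congr 1
    ext n
    simp
    ring

/-- The moment distribution `Tr[ρ b̆_{c 0}(t₀) b̆_{c 1}(t₁) ⋯ b̆_{c (K-1)}(t_{K-1})]`, i.e. an entry
of `Tr[ρ M_b̆(t₀, …, t_{K-1})]`, as a linear functional on the functions of `K` time variables that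
are spanned by products `φ₀(t₀) ⋯ φ_{K-1}(t_{K-1})` of wave packets. On such a product its value
is `Tr[ρ (∫ φ₀ b̆_{c 0}) ⋯ (∫ φ_{K-1} b̆_{c (K-1)})]`. -/
def momentDistribution (ρ : FieldState F) {K : ℕ} (c : Fin K → DoubledIndex m) :
    (⨂[ℂ] _p : Fin K, F.packets) →ₗ[ℂ] ℂ :=
  ρ.expect ∘ₗ PiTensorProduct.lift
    ((MultilinearMap.mkPiAlgebraFin ℂ K F.fieldAlg).compLinearMap fun p => F.smear (c p))

/-- `ρ` is a zero-mean Gaussian (quasi-free) state: the first moments of the field vanish and the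
higher moments are obtained from the second ones by Wick's formula, stated recursively. -/
def IsZeroMeanGaussian (ρ : FieldState F) : Prop :=
  ∀ (x : DoubledIndex m × F.packets) (l : List (DoubledIndex m × F.packets)),
    ρ.expect (F.smear x.1 x.2 * (l.map fun y => F.smear y.1 y.2).prod) =
      ∑ n : Fin l.length,
        ρ.expect (F.smear x.1 x.2 * F.smear (l.get n).1 (l.get n).2) *
          ρ.expect ((l.eraseIdx n).map fun y => F.smear y.1 y.2).prod

/-- `ρ` is stationary with spectral density matrix `R[iω]`: its covariance function is
`Tr[ρ b̆(t) b̆(r)^†] = R(t - r)` with `R(τ) = (1 / 2π) ∫ e^{iωτ} R[iω] dω`. In smeared form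
`Tr[ρ (∫ f b̆_a) (∫ g b̆_c)^*] = (1 / 2π) ∫ R_{ac}[iω] f̂(ω) ĝ(ω)^* dω` with
`f̂(ω) = ∫ e^{iωt} f(t) dt`, and this `f̂(ω)` is Mathlib's `𝓕⁻ f` at `ω / 2π`. -/
def HasSpectralDensity (ρ : FieldState F)
    (R : ℝ → Matrix (DoubledIndex m) (DoubledIndex m) ℂ) : Prop :=
  ∀ (a c : DoubledIndex m) (f g : F.packets),
    Integrable (fun ω : ℝ => R ω a c * (𝓕⁻ (f : L2Time)) (ω / (2 * Real.pi)) *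
      conj ((𝓕⁻ (g : L2Time)) (ω / (2 * Real.pi)))) ∧
    ρ.expect (F.smear a f * F.smearAdj c g) =
      (1 / (2 * Real.pi) : ℂ) * ∫ ω : ℝ, R ω a c * (𝓕⁻ (f : L2Time)) (ω / (2 * Real.pi)) *
        conj ((𝓕⁻ (g : L2Time)) (ω / (2 * Real.pi)))

end FieldState

/-! ### Photon-Gaussian states -/

/-- Kronecker product of `K` column vectors of functions: its entry at the multi-index `a` is the
function `φ₀,ₐ₀(t₀) ⋯ φ_{K-1},ₐ_{K-1}(t_{K-1})`. -/
def kronVec {I V : Type*} [AddCommGroup V] [Module ℂ V] {K : ℕ} (φ : Fin K → I → V) :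
    (Fin K → I) → ⨂[ℂ] _p : Fin K, V :=
  fun a => PiTensorProduct.tprod ℂ fun p => φ p (a p)

/-- Kronecker product of `K` matrices. -/
def kronMat {I : Type*} {K : ℕ} (A : Fin K → Matrix I I ℂ) :
    Matrix (Fin K → I) (Fin K → I) ℂ :=
  Matrix.of fun a c => ∏ p, A p (a p) (c p)

/-- `J = diag(I, -I)`. -/
def matJ (m : ℕ) : Matrix (DoubledIndex m) (DoubledIndex m) ℂ := Matrix.fromBlocks 1 0 0 (-1)

/-- `Θ = [0, I; -I, 0]`. -/
def matTheta (m : ℕ) : Matrix (DoubledIndex m) (DoubledIndex m) ℂ := Matrix.fromBlocks 0 1 (-1) 0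

/-- The index pairs `(j, k)`, `j` a channel and `k` a photon of it, in lexicographic order:
`(1,1), …, (1,ℓ₁), (2,1), …, (m,ℓ_m)`. Its length is `ℓ₁ + ⋯ + ℓ_m`. -/
def photonSlots {m : ℕ} (l : Fin m → ℕ) : List (Σ j : Fin m, Fin (l j)) :=
  (List.finRange m).flatMap fun j => (List.finRange (l j)).map fun k => ⟨j, k⟩

/-- The data of `ξ = Δ(ξ⁻, ξ⁺)`: photon numbers `ℓ_j`, normalization constants `N_{ℓ_j} > 0` and
wave packets `ξ^±_{ijk}` (`i`, `j` channels, `1 ≤ k ≤ ℓ_j`). -/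
structure PhotonTensor {m : ℕ} {H : Type u} [NormedAddCommGroup H] [InnerProductSpace ℂ H]
    (F : BosonField m H) where
  photons : Fin m → ℕ
  norm : Fin m → ℝ
  norm_pos : ∀ j, 0 < norm j
  minus : Fin m → (j : Fin m) → Fin (photons j) → F.packets
  plus : Fin m → (j : Fin m) → Fin (photons j) → F.packets

namespace PhotonTensor

variable {m : ℕ} {H : Type u} [NormedAddCommGroup H] [InnerProductSpace ℂ H]
  {F : BosonField m H}

/-- The operator
`X = ∏_j (1/√N_{ℓ_j}) ∏_k ∑_i (B_i^*(ξ⁻_{ijk}) - B_i(ξ⁺_{ijk}))`, with the (in general not commuting)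
factors ordered from left to right by increasing `j` and `k`. -/
def photonOp (ξ : PhotonTensor F) : F.fieldAlg :=
  (List.ofFn fun j : Fin m => ((1 / Real.sqrt (ξ.norm j) : ℝ) : ℂ) •
    (List.ofFn fun k : Fin (ξ.photons j) =>
      ∑ i, (F.creOp i (ξ.minus i j k) - F.annOp i (ξ.plus i j k))).prod).prod

/-- The column `ξ_{:jk} = (ξ⁻_{:jk} ; (ξ⁺_{:jk})^#)` with `2 m` entries. -/
def column (ξ : PhotonTensor F) (s : Σ j : Fin m, Fin (ξ.photons j)) :
    DoubledIndex m → F.packets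
  | Sum.inl i => ξ.minus i s.1 s.2
  | Sum.inr i => F.conjPacket (ξ.plus i s.1 s.2)

/-- The total number of photons `ℓ₁ + ⋯ + ℓ_m`. -/
abbrev total (ξ : PhotonTensor F) : ℕ := (photonSlots ξ.photons).length

/-- The constant `∏_j 1/√N_{ℓ_j}` in `M_ξ` and in `M_ξ⁺`. -/
def normFactor (ξ : PhotonTensor F) : ℂ := ∏ j, ((1 / Real.sqrt (ξ.norm j) : ℝ) : ℂ)

/-- The factors of the Kronecker product `(M_ξ⁺)^# ⊗ M_ξ`: first the conjugated columns in reversed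
order, then the columns in lexicographic order. -/
def factors (ξ : PhotonTensor F) : Fin (ξ.total + ξ.total) → DoubledIndex m → F.packets :=
  Fin.append
    (fun p a => F.conjPacket (ξ.column ((photonSlots ξ.photons).get p.rev) a))
    (fun p => ξ.column ((photonSlots ξ.photons).get p))

/-- The left-hand side
`∫ ((M_ξ⁺)^# ⊗ M_ξ)^T (J^{⊗L} ⊗ Θ^{⊗L}) Tr[ρ M_b̆(t_{1→2L})] dt_{1→2L}`, `L = ℓ₁ + ⋯ + ℓ_m`, of the
normalization condition. It is the pairing of the moment distributions of `ρ` with the entries of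
the row vector of functions `((M_ξ⁺)^# ⊗ M_ξ)^T (J^{⊗L} ⊗ Θ^{⊗L})`. -/
def normalizationIntegral (ξ : PhotonTensor F) (ρ : FieldState F) : ℂ :=
  ∑ c : Fin (ξ.total + ξ.total) → DoubledIndex m,
    ρ.momentDistribution c
      (∑ a : Fin (ξ.total + ξ.total) → DoubledIndex m,
        kronMat (Fin.append (fun _ => matJ m) (fun _ => matTheta m)) a c •
          ((ξ.normFactor * ξ.normFactor) • kronVec ξ.factors a))

end PhotonTensor

/-- The operator `ρ_{ξ,R} = X ρ_R X^*`. -/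
def photonGaussianOp {m : ℕ} {H : Type u} [NormedAddCommGroup H] [InnerProductSpace ℂ H]
    {F : BosonField m H} (ξ : PhotonTensor F) (ρ : FieldState F) : H →L[ℂ] H :=
  ρ.sandwich ξ.photonOp

/-- The class of photon-Gaussian states of the field `F`: the operators `ρ_{ξ,R}` for which `ρ_R` is
a stationary zero-mean Gaussian state (with some spectral density matrix `R[iω]`) and `ξ`, `ρ_R`
satisfy the normalization condition. -/
def photonGaussianStates {m : ℕ} {H : Type u} [NormedAddCommGroup H] [InnerProductSpace ℂ H]
    (F : BosonField m H) : Set (H →L[ℂ] H) :=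
  {σ | ∃ (ξ : PhotonTensor F) (ρ : FieldState F)
      (R : ℝ → Matrix (DoubledIndex m) (DoubledIndex m) ℂ),
    ρ.IsZeroMeanGaussian ∧ ρ.HasSpectralDensity R ∧ ξ.normalizationIntegral ρ = 1 ∧
      σ = photonGaussianOp ξ ρ}

end

/-! The trace of `X ρ X^*` always exists and always equals the left-hand side of the normalization
condition, so the two are equal to `1` together. Both are computed as `Tr[ρ X^* X]`.

On the trace side, Parseval and Tonelli give `Tr[X ρ X^*] = ∑ₙ pₙ ‖X ψₙ‖²`, finite because all field
moments are (`hasTrace_tsum_rankOne`). Moving one `X` across the inner product turns this into `∑ₙ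
pₙ ⟨ψₙ, X^* X ψₙ⟩` (`FieldState.hasTrace_sandwich`).

On the integral side, `ξ^T Θ b̆` smears to one factor of `X` and `ξ^† J b̆` to its adjoint. The
Kronecker powers of `J` and `Θ` are the coefficients obtained by multiplying out the product of all
factors, and the reversed order in `M_ξ⁺` is the reversal of a product under the adjoint
(`PhotonTensor.normalizationIntegral_eq_expect`). -/

noncomputable section

/-! ### Ordered products and multilinear expansion -/

namespace List

variable {ι R A : Type*}

theorem prod_map_smul' [CommSemiring R] [Semiring A] [Algebra R A] (l : List ι) (c : ι → R)
    (g : ι → A) :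
    (l.map fun j => c j • g j).prod = (l.map c).prod • (l.map g).prod := by
  induction l with
  | nil => simp
  | cons j l ih => simp only [map_cons, prod_cons, ih, smul_mul_smul_comm]

theorem prod_map_flatMap {κ : Type*} [Monoid A] (l : List ι) (s : ι → List κ) (g : κ → A) :
    ((l.flatMap s).map g).prod = (l.map fun j => ((s j).map g).prod).prod := by
  induction l with
  | nil => simp
  | cons j l ih => simp [ih]

end List

namespace MultilinearMap

/-- Expansion of a multilinear map at linear combinations with coefficient matrices. -/
theorem map_sum_matrix_smul {ι I R V W : Type*} [Fintype ι] [DecidableEq ι] [Fintype I]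
    [CommSemiring R] [AddCommMonoid V] [Module R V] [AddCommMonoid W] [Module R W]
    (f : MultilinearMap R (fun _ : ι => V) W) (A : ι → Matrix I I R) (v : ι → I → I → V) :
    f (fun p => ∑ c, ∑ a, A p a c • v p a c) =
      ∑ c : ι → I, ∑ a : ι → I, (∏ p, A p (a p) (c p)) • f fun p => v p (a p) (c p) := by
  classical
  rw [f.map_sum]
  refine Finset.sum_congr rfl fun c _ => ?_
  rw [f.map_sum]
  refine Finset.sum_congr rfl fun a _ => ?_
  rw [f.map_smul_univ]

end MultilinearMap

/-! ### Traces of mixtures of rank-one operators -/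

/-- The trace of a mixture `∑ₙ wₙ |xₙ⟩⟨xₙ|` is `∑ₙ wₙ ‖xₙ‖²`. -/
theorem hasTrace_tsum_rankOne {H : Type u} [NormedAddCommGroup H] [InnerProductSpace ℂ H]
    [CompleteSpace H] (w : ℕ → ℝ) (hw : ∀ n, 0 ≤ w n) (x : ℕ → H)
    (hs : Summable fun n => w n * ‖x n‖ ^ 2) :
    HasTrace (∑' n, (w n : ℂ) • InnerProductSpace.rankOne ℂ (x n) (x n))
      ((∑' n, w n * ‖x n‖ ^ 2 : ℝ) : ℂ) := by
  intro ι e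
  -- The series converges absolutely in operator norm, since `|x⟩⟨x|` has norm `‖x‖²`; hence the
  -- `tsum` is a genuine sum and matrix entries can be taken termwise.
  have hop : Summable fun n => (w n : ℂ) • InnerProductSpace.rankOne ℂ (x n) (x n) := by
    refine Summable.of_norm_bounded hs fun n => ?_
    rw [norm_smul, Complex.norm_real, Real.norm_of_nonneg (hw n),
      InnerProductSpace.norm_rankOne, sq]
  have hdiag (i : ι) : HasSum (fun n => ((w n * ‖inner ℂ (e i) (x n)‖ ^ 2 : ℝ) : ℂ))
      (inner ℂ (e i)
        ((∑' n, (w n : ℂ) • InnerProductSpace.rankOne ℂ (x n) (x n) : H →L[ℂ] H) (e i))) := by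
    have h := (hop.hasSum.mapL (ContinuousLinearMap.apply ℂ H (e i))).mapL (innerSL ℂ (e i))
    refine (congrArg (HasSum · _) (funext fun n => ?_)).mp h
    change inner ℂ (e i) ((w n : ℂ) • InnerProductSpace.rankOne ℂ (x n) (x n) (e i)) = _
    rw [InnerProductSpace.rankOne_apply, inner_smul_right, inner_smul_right,
      ← inner_conj_symm (x n) (e i), Complex.conj_mul']
    push_cast
    rfl
  -- Parseval for `x n` in the basis `e`.
  have hcol (n : ℕ) : HasSum (fun i => w n * ‖inner ℂ (e i) (x n)‖ ^ 2) (w n * ‖x n‖ ^ 2) := by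
    refine HasSum.mul_left _ (Complex.hasSum_ofReal.1 ?_)
    have h := e.hasSum_inner_mul_inner (x n) (x n)
    rw [inner_self_eq_norm_sq_to_K] at h
    rw [Complex.ofReal_pow]
    refine (congrArg (HasSum · _) (funext fun i => ?_)).mp h
    rw [← inner_conj_symm (x n) (e i), Complex.conj_mul', Complex.ofReal_pow]
  -- All terms are nonnegative, so summability of the iterated sum gives summability of the double
  -- sum, and the order of summation may be exchanged.
  have hprod : Summable fun q : ℕ × ι => w q.1 * ‖inner ℂ (e q.2) (x q.1)‖ ^ 2 := by
    refine (summable_prod_of_nonneg fun q => mul_nonneg (hw _) (sq_nonneg _)).2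
      ⟨fun n => (hcol n).summable, ?_⟩
    simpa only [(hcol _).tsum_eq] using hs
  have htot : HasSum (fun q : ℕ × ι => w q.1 * ‖inner ℂ (e q.2) (x q.1)‖ ^ 2)
      (∑' n, w n * ‖x n‖ ^ 2) := by
    have h := hprod.hasSum.prod_fiberwise hcol
    rw [h.tsum_eq]
    exact hprod.hasSum
  have hswap := (Equiv.prodComm ι ℕ).hasSum_iff.2 (Complex.hasSum_ofReal.2 htot)
  exact hswap.prod_fiberwise hdiag

/-! ### Formal adjoints in the field algebra -/

namespace BosonField

variable {m : ℕ} {H : Type u} [NormedAddCommGroup H] [InnerProductSpace ℂ H]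

theorem conjPacket_conjPacket (F : BosonField m H) (f : F.packets) :
    F.conjPacket (F.conjPacket f) = f :=
  Subtype.ext (star_star (f : L2Time))

/-- `B` is a formal adjoint of `A` on the domain of the fields. -/
def IsFormalAdjoint (F : BosonField m H) (A B : F.fieldAlg) : Prop :=
  ∀ x y : F.dom, inner ℂ ((A : Module.End ℂ F.dom) x : H) (y : H) =
    inner ℂ (x : H) ((B : Module.End ℂ F.dom) y : H)

variable {F : BosonField m H}

theorem isFormalAdjoint_creOp (i : Fin m) (f : F.packets) :
    F.IsFormalAdjoint (F.creOp i f) (F.annOp i f) :=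
  F.adjoint i f

theorem IsFormalAdjoint.symm {A B : F.fieldAlg} (h : F.IsFormalAdjoint A B) :
    F.IsFormalAdjoint B A := by
  intro x y
  rw [← inner_conj_symm, ← h y x, inner_conj_symm]

theorem IsFormalAdjoint.sub {A B A' B' : F.fieldAlg} (h : F.IsFormalAdjoint A B)
    (h' : F.IsFormalAdjoint A' B') : F.IsFormalAdjoint (A - A') (B - B') := by
  intro x y
  change inner ℂ (((A : Module.End ℂ F.dom) x : H) - ((A' : Module.End ℂ F.dom) x : H)) (y : H) =
    inner ℂ (x : H) (((B : Module.End ℂ F.dom) y : H) - ((B' : Module.End ℂ F.dom) y : H))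
  rw [inner_sub_left, inner_sub_right, h x y, h' x y]

theorem IsFormalAdjoint.mul {A B A' B' : F.fieldAlg} (h : F.IsFormalAdjoint A B)
    (h' : F.IsFormalAdjoint A' B') : F.IsFormalAdjoint (A * A') (B' * B) := by
  intro x y
  simp [h _ y, h' x _]

theorem IsFormalAdjoint.smul {A B : F.fieldAlg} (h : F.IsFormalAdjoint A B) (c : ℂ) :
    F.IsFormalAdjoint (c • A) (conj c • B) := by
  intro x y
  change inner ℂ (c • ((A : Module.End ℂ F.dom) x : H)) (y : H) =
    inner ℂ (x : H) (conj c • ((B : Module.End ℂ F.dom) y : H))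
  rw [inner_smul_left, inner_smul_right, h x y]

theorem IsFormalAdjoint.sum {ι : Type*} (s : Finset ι) {A B : ι → F.fieldAlg}
    (h : ∀ i, F.IsFormalAdjoint (A i) (B i)) :
    F.IsFormalAdjoint (∑ i ∈ s, A i) (∑ i ∈ s, B i) := by
  intro x y
  simp [h _ x y]

/-- Adjoints reverse products; this is the source of the reversed column order in `M_ξ⁺`. -/
theorem IsFormalAdjoint.list_prod {ι : Type*} {A B : ι → F.fieldAlg}
    (h : ∀ i, F.IsFormalAdjoint (A i) (B i)) (l : List ι) :
    F.IsFormalAdjoint (l.map A).prod (l.reverse.map B).prod := by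
  induction l with
  | nil => exact fun x y => rfl
  | cons i l ih =>
    simpa using (h i).mul ih

end BosonField

/-! ### Contractions with `Θ` and `J` -/

open BosonField

theorem sum_matTheta_smul {m : ℕ} {M : Type*} [AddCommGroup M] [Module ℂ M]
    (v : DoubledIndex m → DoubledIndex m → M) :
    ∑ c, ∑ a, matTheta m a c • v c a =
      ∑ i, (v (Sum.inr i) (Sum.inl i) - v (Sum.inl i) (Sum.inr i)) := by
  simp [matTheta, Matrix.one_apply, Finset.sum_sub_distrib, neg_add_eq_sub]

theorem sum_matJ_smul {m : ℕ} {M : Type*} [AddCommGroup M] [Module ℂ M]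
    (v : DoubledIndex m → DoubledIndex m → M) :
    ∑ c, ∑ a, matJ m a c • v c a =
      ∑ i, (v (Sum.inl i) (Sum.inl i) - v (Sum.inr i) (Sum.inr i)) := by
  simp [matJ, Matrix.one_apply, Finset.sum_sub_distrib, ← sub_eq_add_neg]

/-! ### The trace as an expectation -/

namespace FieldState

variable {m : ℕ} {H : Type u} [NormedAddCommGroup H] [InnerProductSpace ℂ H]
  {F : BosonField m H}

/-- Termwise, `‖X ψ‖² = ⟨X ψ, X ψ⟩ = ⟨ψ, Y X ψ⟩`. -/
theorem tsum_weight_mul_norm_sq (ρ : FieldState F) {X Y : F.fieldAlg}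
    (h : F.IsFormalAdjoint X Y) :
    ((∑' n, ρ.weight n * ‖((X : Module.End ℂ F.dom) (ρ.vec n) : H)‖ ^ 2 : ℝ) : ℂ) =
      ρ.expect (Y * X) := by
  rw [Complex.ofReal_tsum]
  change _ = ∑' n, _
  refine tsum_congr fun n => ?_
  have h1 := h (ρ.vec n) ((X : Module.End ℂ F.dom) (ρ.vec n))
  rw [inner_self_eq_norm_sq_to_K] at h1
  push_cast
  simp only [Module.End.mul_apply]
  rw [← h1]
  rfl

/-- `Tr[X ρ X^*] = Tr[ρ X^* X]`. -/
theorem hasTrace_sandwich [CompleteSpace H] (ρ : FieldState F) {X Y : F.fieldAlg}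
    (h : F.IsFormalAdjoint X Y) : HasTrace (ρ.sandwich X) (ρ.expect (Y * X)) := by
  rw [← ρ.tsum_weight_mul_norm_sq h]
  exact hasTrace_tsum_rankOne ρ.weight ρ.weight_nonneg _ (ρ.moments X X.2)

end FieldState

/-- `HasTrace` quantifies over all bases, so uniqueness needs at least one to exist; completeness of
`H` provides it. -/
theorem HasTrace.unique {H : Type u} [NormedAddCommGroup H] [InnerProductSpace ℂ H]
    [CompleteSpace H] {A : H →L[ℂ] H} {s t : ℂ} (hs : HasTrace A s) (ht : HasTrace A t) :
    s = t := by
  obtain ⟨w, e, -⟩ := exists_hilbertBasis ℂ H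
  exact (hs w e).unique (ht w e)

/-! ### The photon operator and the normalization integral -/

namespace PhotonTensor

variable {m : ℕ} {H : Type u} [NormedAddCommGroup H] [InnerProductSpace ℂ H]
  {F : BosonField m H}

/-- The single factor `∑_i (B_i^*(ξ⁻_{ijk}) - B_i(ξ⁺_{ijk}))` of the photon operator. -/
def slotOp (ξ : PhotonTensor F) (s : Σ j : Fin m, Fin (ξ.photons j)) : F.fieldAlg :=
  ∑ i, (F.creOp i (ξ.minus i s.1 s.2) - F.annOp i (ξ.plus i s.1 s.2))

/-- The formal adjoint of `slotOp`. -/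
def slotOpAdj (ξ : PhotonTensor F) (s : Σ j : Fin m, Fin (ξ.photons j)) : F.fieldAlg :=
  ∑ i, (F.annOp i (ξ.minus i s.1 s.2) - F.creOp i (ξ.plus i s.1 s.2))

theorem isFormalAdjoint_slotOp (ξ : PhotonTensor F) (s : Σ j : Fin m, Fin (ξ.photons j)) :
    F.IsFormalAdjoint (ξ.slotOp s) (ξ.slotOpAdj s) :=
  .sum _ fun i => (isFormalAdjoint_creOp i _).sub (isFormalAdjoint_creOp i _).symm

/-- `Θ` pairs `ξ⁻` with `b^*`, and `(ξ⁺)^#` with `b` up to sign. Smearing `b` conjugates its packet,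
which undoes the conjugation in the lower half of the column. -/
theorem slotOp_eq_sum_matTheta (ξ : PhotonTensor F) (s : Σ j : Fin m, Fin (ξ.photons j)) :
    ∑ c, ∑ a, matTheta m a c • F.smear c (ξ.column s a) = ξ.slotOp s := by
  refine (sum_matTheta_smul fun c a => F.smear c (ξ.column s a)).trans ?_
  simp only [column, smear, LinearMap.coe_mk, AddHom.coe_mk, conjPacket_conjPacket, slotOp]

/-- Conjugating the column makes `J` pair `(ξ⁻)^#` with `b` and `ξ⁺` with `-b^*`, which are the
adjoint terms. -/
theorem slotOpAdj_eq_sum_matJ (ξ : PhotonTensor F) (s : Σ j : Fin m, Fin (ξ.photons j)) :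
    ∑ c, ∑ a, matJ m a c • F.smear c (F.conjPacket (ξ.column s a)) = ξ.slotOpAdj s := by
  refine (sum_matJ_smul fun c a => F.smear c (F.conjPacket (ξ.column s a))).trans ?_
  simp only [column, smear, LinearMap.coe_mk, AddHom.coe_mk, conjPacket_conjPacket, slotOpAdj]

/-- The scalars are central and the slots are listed lexicographically, so the nested product
flattens to a single ordered product over slots. -/
theorem photonOp_eq (ξ : PhotonTensor F) :
    ξ.photonOp = ξ.normFactor • ((photonSlots ξ.photons).map ξ.slotOp).prod := by
  rw [photonSlots, List.prod_map_flatMap, photonOp, List.ofFn_eq_map, List.prod_map_smul',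
    ← List.ofFn_eq_map (f := fun j : Fin m => ((1 / Real.sqrt (ξ.norm j) : ℝ) : ℂ)),
    List.prod_ofFn]
  simp only [List.map_map, List.ofFn_eq_map]
  rfl

/-- The constant is real, so `X` and its adjoint carry the same one and the integral contains its
plain square. -/
theorem conj_normFactor (ξ : PhotonTensor F) : conj ξ.normFactor = ξ.normFactor := by
  simp only [normFactor, map_prod, Complex.conj_ofReal]

/-- The formal adjoint of the photon operator. -/
def photonOpAdj (ξ : PhotonTensor F) : F.fieldAlg :=
  ξ.normFactor • ((photonSlots ξ.photons).reverse.map ξ.slotOpAdj).prod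

theorem isFormalAdjoint_photonOp (ξ : PhotonTensor F) :
    F.IsFormalAdjoint ξ.photonOp ξ.photonOpAdj := by
  have h := (IsFormalAdjoint.list_prod ξ.isFormalAdjoint_slotOp
    (photonSlots ξ.photons)).smul ξ.normFactor
  rwa [conj_normFactor, ← photonOp_eq] at h

/-- The left-hand side of the normalization condition is `Tr[ρ X^* X]`. -/
theorem normalizationIntegral_eq_expect (ξ : PhotonTensor F) (ρ : FieldState F) :
    ξ.normalizationIntegral ρ = ρ.expect (ξ.photonOpAdj * ξ.photonOp) := by
  -- Slot by slot, the matrix contractions give the factors of `X^*` in the first half and those of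
  -- `X` in the second.
  have hop : (fun p => ∑ c, ∑ a,
      (Fin.append (fun _ : Fin ξ.total => matJ m) (fun _ : Fin ξ.total => matTheta m)) p a c •
        F.smear c (ξ.factors p a)) =
      Fin.append (fun p => ξ.slotOpAdj ((photonSlots ξ.photons).get p.rev))
        (fun p => ξ.slotOp ((photonSlots ξ.photons).get p)) := by
    funext p
    refine Fin.addCases (fun p => ?_) (fun p => ?_) p
    · simp only [factors, Fin.append_left]
      exact ξ.slotOpAdj_eq_sum_matJ _
    · simp only [factors, Fin.append_right]
      exact ξ.slotOp_eq_sum_matTheta _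
  -- Multiplying out `X^* X`, without its constants, by multilinearity: the coefficients that appear
  -- are the entries of `J^{⊗L} ⊗ Θ^{⊗L}`.
  have hprod := (MultilinearMap.mkPiAlgebraFin ℂ (ξ.total + ξ.total) F.fieldAlg).map_sum_matrix_smul
    (Fin.append (fun _ : Fin ξ.total => matJ m) (fun _ : Fin ξ.total => matTheta m))
    (fun p a c => F.smear c (ξ.factors p a))
  rw [hop, MultilinearMap.mkPiAlgebraFin_apply, List.ofFn_fin_append, List.prod_append] at hprod
  have hrev : (List.ofFn fun p => ξ.slotOpAdj ((photonSlots ξ.photons).get (Fin.rev p))) =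
      (photonSlots ξ.photons).reverse.map ξ.slotOpAdj := by
    apply List.ext_get
    · simp
    · intro n h1 h2
      simp only [List.get_eq_getElem, List.getElem_ofFn, List.getElem_map, List.getElem_reverse,
        Fin.val_rev]
      -- Both sides read the same slot: the index is `L - (n + 1)` from `Fin.rev` and `L - 1 - n`
      -- from `List.reverse`.
      congr 2
      omega
  have hfwd : (List.ofFn fun p => ξ.slotOp ((photonSlots ξ.photons).get p)) =
      (photonSlots ξ.photons).map ξ.slotOp := by
    apply List.ext_get <;> simp
  rw [hrev, hfwd] at hprod
  rw [photonOpAdj, photonOp_eq, smul_mul_smul_comm, hprod]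
  simp only [normalizationIntegral, FieldState.momentDistribution, kronMat, kronVec, map_sum,
    map_smul, LinearMap.comp_apply, PiTensorProduct.lift.tprod, Finset.smul_sum, Matrix.of_apply,
    MultilinearMap.compLinearMap_apply]
  refine Finset.sum_congr rfl fun c _ => Finset.sum_congr rfl fun a _ => ?_
  -- The two sides differ only in the order of the matrix entry and the squared constant.
  exact smul_comm _ _ _

end PhotonTensor

/-! ### Conclusion -/

theorem hasTrace_photonGaussianOp {m : ℕ} {H : Type u} [NormedAddCommGroup H]
    [InnerProductSpace ℂ H] [CompleteSpace H] {F : BosonField m H} (ξ : PhotonTensor F)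
    (ρ : FieldState F) :
    HasTrace (photonGaussianOp ξ ρ) (ξ.normalizationIntegral ρ) := by
  rw [ξ.normalizationIntegral_eq_expect]
  exact ρ.hasTrace_sandwich ξ.isFormalAdjoint_photonOp

end

theorem mainTheorem9 {m : ℕ} {H : Type*} [NormedAddCommGroup H] [InnerProductSpace ℂ H]
    [CompleteSpace H] (F : BosonField m H) :
    (∀ σ ∈ photonGaussianStates F, HasTrace σ 1) ∧
    (∀ (ξ : PhotonTensor F) (ρ : FieldState F)
      (R : ℝ → Matrix (DoubledIndex m) (DoubledIndex m) ℂ),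
      ρ.IsZeroMeanGaussian → ρ.HasSpectralDensity R →
        (HasTrace (photonGaussianOp ξ ρ) 1 ↔ ξ.normalizationIntegral ρ = 1)) := by
  refine ⟨?_, fun ξ ρ _ _ _ => ⟨fun h => (hasTrace_photonGaussianOp ξ ρ).unique h, fun h => ?_⟩⟩
  · rintro σ ⟨ξ, ρ, R, -, -, h, rfl⟩
    exact h ▸ hasTrace_photonGaussianOp ξ ρ
  · exact h ▸ hasTrace_photonGaussianOp ξ ρ
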